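/- For $u\in L^2(\mathbb R^3;\mathbb R)$ let $\hat u(\xi)=\int e^{-2\pi i\xi\cdot x}u(x)\,dx$ (extended to $L^2$), $\|u\|^2_{H^{1/2}}=\int_{\mathbb R^3}(1+2\pi|\xi|)|\hat u(\xi)|^2d\xi$, $H^{1/2}=\{u\in L^2(\mathbb R^3;\mathbb R):\|u\|_{H^{1/2}}<\infty\}$ and $\phi_u(x)=\int_{\mathbb R^3}\frac{u(y)^2}{|x-y|}\,dy$. Solutions in $H^{1/2}$ are understood in the weak sense (tested against all $w\in H^{1/2}$, with $\sqrt{-\Delta}$ the Fourier multiplier $2\pi|\xi|$). Let $Q$ be a ground state solution of $\sqrt{-\Delta}\,u+u=\phi_u u$ in $H^{1/2}$, that is, a solution which minimizes $\frac12\|u\|^2_{H^{1/2}}-\frac14\int\phi_u u^2dx$ over $\{u\in H^{1/2}: u\neq0,\ \|u\|^2_{H^{1/2}}=\int\phi_u u^2dx\}$ and belongs to this set (for instance a positive radially symmetric one). Let $a,\beta>0$, $a\ne\beta$, and consider the system $$\sqrt{-\Delta}\,u+u=a\phi_u u+\beta\phi_v u,\qquad \sqrt{-\Delta}\,v+v=a\phi_v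 v+\beta\phi_u v,\qquad (u,v)\in H^{1/2}\times H^{1/2},$$ with energy $$J(u,v)=\tfrac12\big(\|u\|^2_{H^{1/2}}+\|v\|^2_{H^{1/2}}\big)-\tfrac14\int_{\mathbb R^3}\big(a\phi_u u^2+a\phi_v v^2+2\beta\phi_u v^2\big)dx$$ and Nehari manifold $$\mathcal N=\Big\{(u,v)\in H^{1/2}\times H^{1/2}:\ u\ne0,\ v\neq 0,\ \|u\|^2_{H^{1/2}}=\int(a\phi_u u^2+\beta\phi_v u^2)dx,\ \|v\|^2_{H^{1/2}}=\int(a\phi_v v^2+\beta\phi_u v^2)dx\Big\}.$$ If $k,l>0$ satisfy $ak+\beta l=1$ and $al+\beta k=1$, then $(u_0,v_0)=(\sqrt k\,Q,\sqrt l\,Q)$ is a ground state solution of the system: it solves the system, it belongs to $\mathcal N$, and $J(u_0,v_0)=\min_{\mathcal N}J$. If moreover $a<\beta$, then $(u_0,v_0)$ also minimizes $J$ over the larger set obtained from $\mathcal N$ by replacing the condition "$u\neq0$, $v\ne0$" with $(u,v)\neq(0,0)$. -/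

import Mathlib

open MeasureTheory
open scoped FourierTransform

noncomputable section

namespace Hartree

/-- Euclidean space `ℝ³`. -/
abbrev R3 : Type := EuclideanSpace ℝ (Fin 3)

/-- Real-valued `L²(ℝ³)`. -/
abbrev L2 : Type := Lp (α := R3) ℝ 2

/-- The `L²` Fourier transform (kernel `exp (-2πi ξ·x)`) of a real-valued `L²` function. -/
def hat (u : L2) : Lp (α := R3) ℂ 2 := 𝓕 (Complex.ofRealCLM.compLp u)

/-- The Sobolev space `H^{1/2}(ℝ³)` of real-valued functions. -/
def Hhalf : Set L2 :=
  {u | Integrable (fun ξ : R3 => (1 + 2 * Real.pi * ‖ξ‖) * ‖hat u ξ‖ ^ 2)}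

/-- The squared norm `‖u‖² = ∫ (1 + 2π|ξ|) |û(ξ)|² dξ = ∫ (|(-Δ)^{1/4} u|² + u²) dx`. -/
def normSq (u : L2) : ℝ := ∫ ξ : R3, (1 + 2 * Real.pi * ‖ξ‖) * ‖hat u ξ‖ ^ 2

/-- The quadratic-form pairing `((√(-Δ) + 1) u, w) = ∫ (1 + 2π|ξ|) û(ξ) conj(ŵ(ξ)) dξ`;
for real-valued `u` and `w` the integral is real, so its real part is taken under the integral. -/
def form (u w : L2) : ℝ :=
  ∫ ξ : R3, (1 + 2 * Real.pi * ‖ξ‖) * (hat u ξ * star (hat w ξ)).re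

/-- The Hartree potential `φ_u = |x|⁻¹ ∗ u²`. -/
def phi (u : L2) (x : R3) : ℝ := ∫ y : R3, u y ^ 2 / ‖x - y‖

/-- `D u v = ∫ φ_u v² dx`. -/
def D (u v : L2) : ℝ := ∫ x : R3, phi u x * v x ^ 2

/-! ### The scalar equation `√(-Δ) u + u = φ_u u` -/

/-- `u ∈ H^{1/2}` is a weak solution of `√(-Δ) u + u = φ_u u`. -/
def IsScalarSolution (u : L2) : Prop :=
  u ∈ Hhalf ∧ ∀ w ∈ Hhalf, form u w = ∫ x : R3, phi u x * u x * w x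

/-- Energy of the scalar equation. -/
def scalarEnergy (u : L2) : ℝ := normSq u / 2 - D u u / 4

/-- Nehari manifold of the scalar equation. -/
def scalarNehari : Set L2 := {u | u ∈ Hhalf ∧ u ≠ 0 ∧ normSq u = D u u}

/-- Ground state solution of the scalar equation: a solution that minimizes the energy over the
Nehari manifold. -/
def IsScalarGroundState (u : L2) : Prop :=
  IsScalarSolution u ∧ u ∈ scalarNehari ∧ IsMinOn scalarEnergy scalarNehari u

/-! ### The system `√(-Δ) u + u = a φ_u u + β φ_v u`, `√(-Δ) v + v = a φ_v v + β φ_u v` -/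

/-- `(u, v) ∈ H^{1/2} × H^{1/2}` is a weak solution of the system. -/
def IsSystemSolution (a β : ℝ) (z : L2 × L2) : Prop :=
  z.1 ∈ Hhalf ∧ z.2 ∈ Hhalf ∧
  (∀ w ∈ Hhalf, form z.1 w =
    ∫ x : R3, (a * phi z.1 x * z.1 x + β * phi z.2 x * z.1 x) * w x) ∧
  (∀ w ∈ Hhalf, form z.2 w =
    ∫ x : R3, (a * phi z.2 x * z.2 x + β * phi z.1 x * z.2 x) * w x)

/-- The energy functional of the system. -/
def J (a β : ℝ) (z : L2 × L2) : ℝ :=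
  (normSq z.1 + normSq z.2) / 2
    - (∫ x : R3, (a * (phi z.1 x * z.1 x ^ 2) + a * (phi z.2 x * z.2 x ^ 2)
        + 2 * β * (phi z.1 x * z.2 x ^ 2))) / 4

/-- The two Nehari constraints on a pair in `H^{1/2} × H^{1/2}`. -/
def NehariConstraints (a β : ℝ) (z : L2 × L2) : Prop :=
  z.1 ∈ Hhalf ∧ z.2 ∈ Hhalf ∧
  normSq z.1 = ∫ x : R3, (a * (phi z.1 x * z.1 x ^ 2) + β * (phi z.2 x * z.1 x ^ 2)) ∧
  normSq z.2 = ∫ x : R3, (a * (phi z.2 x * z.2 x ^ 2) + β * (phi z.1 x * z.2 x ^ 2))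

/-- The Nehari manifold of the system: both components are nonzero. -/
def nehari (a β : ℝ) : Set (L2 × L2) :=
  {z | z.1 ≠ 0 ∧ z.2 ≠ 0 ∧ NehariConstraints a β z}

/-- The larger set in which only `(0, 0)` is excluded, so that one component may vanish. -/
def nehariWide (a β : ℝ) : Set (L2 × L2) :=
  {z | z ≠ (0, 0) ∧ NehariConstraints a β z}

/-- Ground state solution of the system: a solution that minimizes the energy over the Nehari
manifold. -/
def IsGroundState (a β : ℝ) (z : L2 × L2) : Prop :=
  IsSystemSolution a β z ∧ z ∈ nehari a β ∧ IsMinOn (J a β) (nehari a β) z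

end Hartree

end

/-! Write A = ‖u‖², B = ‖v‖², M = ‖Q‖². The constraints give J = (A + B)/4, so A + B must be bounded
below. Rescaling onto the scalar Nehari manifold turns minimality of Q into M ∫φ_u u² ≤ A²
(`normSq_mul_D_le`), and Cauchy–Schwarz for the Coulomb energy (`D_sq_le`) then gives M ∫φ_v u² ≤
AB. Inserting both in the first constraint and dividing by A > 0 yields M ≤ aA + βB
(`le_of_fst_ne_zero`); symmetrically M ≤ aB + βA. The sum is 2M ≤ (a + β)(A + B), with equality for
the synchronized pair because (a + β)(k + l) = 2. If one component vanishes, only one inequality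
survives, say M ≤ aA, and a < β gives the same bound.

Cauchy–Schwarz holds because 1/|x - y| is a superposition of products of Gaussians. It is proved
with values in [0, ∞]; the finiteness needed to return to real integrals is read off from the
constraints, so no Hardy–Littlewood–Sobolev estimate enters. -/

open Set
open scoped ENNReal

namespace Hartree

/-! ### Cauchy–Schwarz for factored kernels -/

section KernelFactorization

variable {X P : Type*} [MeasurableSpace X] [MeasurableSpace P] {ν : Measure X} {μ : Measure P}
  [SFinite ν] [SFinite μ]

/-- Tonelli for a kernel that factors through an auxiliary measure space. -/
lemma lintegral_factored_kernel {κ : P → X → ℝ≥0∞} (hκ : Measurable (Function.uncurry κ))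
    {f g : X → ℝ≥0∞} (hf : Measurable f) (hg : Measurable g) :
    ∫⁻ x, ∫⁻ y, f x * g y * ∫⁻ p, κ p x * κ p y ∂μ ∂ν ∂ν =
      ∫⁻ p, (∫⁻ x, f x * κ p x ∂ν) * (∫⁻ y, g y * κ p y ∂ν) ∂μ := by
  have hκ1 (p : P) : Measurable (κ p) := hκ.of_uncurry_left
  have hκ2 (x : X) : Measurable fun p => κ p x := hκ.of_uncurry_right
  have hG : Measurable fun p => ∫⁻ y, g y * κ p y ∂ν := by
    apply Measurable.lintegral_prod_right' (f := fun q : P × X => g q.2 * κ q.1 q.2)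
    exact (hg.comp measurable_snd).mul hκ
  calc ∫⁻ x, ∫⁻ y, f x * g y * ∫⁻ p, κ p x * κ p y ∂μ ∂ν ∂ν
      = ∫⁻ x, ∫⁻ y, ∫⁻ p, f x * κ p x * (g y * κ p y) ∂μ ∂ν ∂ν := by
        refine lintegral_congr fun x => lintegral_congr fun y => ?_
        rw [← lintegral_const_mul _ ((hκ2 x).fun_mul (hκ2 y))]
        refine lintegral_congr fun p => ?_
        ring
    _ = ∫⁻ x, ∫⁻ p, ∫⁻ y, f x * κ p x * (g y * κ p y) ∂ν ∂μ ∂ν := by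
        refine lintegral_congr fun x => lintegral_lintegral_swap ?_
        refine Measurable.aemeasurable ?_
        refine Measurable.mul (measurable_const.mul ((hκ2 x).comp measurable_snd)) ?_
        exact (hg.comp measurable_fst).mul (hκ.comp measurable_swap)
    _ = ∫⁻ x, ∫⁻ p, f x * κ p x * ∫⁻ y, g y * κ p y ∂ν ∂μ ∂ν := by
        refine lintegral_congr fun x => lintegral_congr fun p => ?_
        rw [lintegral_const_mul _ (hg.fun_mul (hκ1 p))]
    _ = ∫⁻ p, ∫⁻ x, f x * κ p x * ∫⁻ y, g y * κ p y ∂ν ∂ν ∂μ := by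
        refine lintegral_lintegral_swap (Measurable.aemeasurable ?_)
        refine Measurable.mul ((hf.comp measurable_fst).mul (hκ.comp measurable_swap)) ?_
        exact hG.comp measurable_snd
    _ = _ := by
        refine lintegral_congr fun p => ?_
        rw [lintegral_mul_const _ (hf.fun_mul (hκ1 p))]

/-- Cauchy–Schwarz for the quadratic form of a kernel that factors through an auxiliary
measure space. -/
lemma lintegral_factored_kernel_le {κ : P → X → ℝ≥0∞} (hκ : Measurable (Function.uncurry κ))
    {f g : X → ℝ≥0∞} (hf : Measurable f) (hg : Measurable g) :
    ∫⁻ x, ∫⁻ y, f x * g y * ∫⁻ p, κ p x * κ p y ∂μ ∂ν ∂ν ≤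
      (∫⁻ x, ∫⁻ y, f x * f y * ∫⁻ p, κ p x * κ p y ∂μ ∂ν ∂ν) ^ (1 / 2 : ℝ) *
      (∫⁻ x, ∫⁻ y, g x * g y * ∫⁻ p, κ p x * κ p y ∂μ ∂ν ∂ν) ^ (1 / 2 : ℝ) := by
  have hF {h : X → ℝ≥0∞} (hh : Measurable h) : Measurable fun p => ∫⁻ y, h y * κ p y ∂ν := by
    apply Measurable.lintegral_prod_right' (f := fun q : P × X => h q.2 * κ q.1 q.2)
    exact (hh.comp measurable_snd).mul hκ
  rw [lintegral_factored_kernel hκ hf hg, lintegral_factored_kernel hκ hf hf,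
    lintegral_factored_kernel hκ hg hg]
  have := ENNReal.lintegral_mul_le_Lp_mul_Lq μ Real.HolderConjugate.two_two
    (hF hf).aemeasurable (hF hg).aemeasurable
  simpa only [ENNReal.rpow_two, sq, Pi.mul_apply] using this

end KernelFactorization

/-! ### Positivity of the Coulomb kernel -/

/-- Gaussian factor of the Coulomb kernel, at scale `p.1` and centre `p.2`. -/
noncomputable def gaussFactor (p : ℝ × R3) (x : R3) : ℝ≥0∞ :=
  ENNReal.ofReal ((Real.pi / (4 * p.1 ^ 2)) ^ (-(3 / 4) : ℝ) *
    Real.exp (-(2 * p.1 ^ 2 * ‖x - p.2‖ ^ 2)))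

lemma measurable_gaussFactor : Measurable (Function.uncurry gaussFactor) := by
  unfold gaussFactor Function.uncurry
  fun_prop

lemma lintegral_gaussFactor_mul (x y : R3) {t : ℝ} (ht : 0 < t) :
    ∫⁻ z, gaussFactor (t, z) x * gaussFactor (t, z) y =
      ENNReal.ofReal (Real.exp (-t ^ 2 * ‖x - y‖ ^ 2)) := by
  set c : ℝ := (Real.pi / (4 * t ^ 2)) ^ (-(3 / 4) : ℝ)
  have hb : 0 < Real.pi / (4 * t ^ 2) := by positivity
  have hc : 0 < c := Real.rpow_pos_of_pos hb _
  have h4 : (0 : ℝ) < 4 * t ^ 2 := by positivity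
  have hint : Integrable fun z : R3 => Real.exp (-(4 * t ^ 2) * ‖z‖ ^ 2) := by
    -- A nonintegrable function has Bochner integral 0, so a positive value forces integrability.
    refine not_imp_comm.1 integral_undef ?_
    rw [GaussianFourier.integral_rexp_neg_mul_sq_norm h4]
    positivity
  set m : R3 := (2⁻¹ : ℝ) • (x + y)
  have key (z : R3) : gaussFactor (t, z) x * gaussFactor (t, z) y =
      ENNReal.ofReal (c ^ 2 * Real.exp (-t ^ 2 * ‖x - y‖ ^ 2) *
        Real.exp (-(4 * t ^ 2) * ‖z - m‖ ^ 2)) := by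
    -- The parallelogram law completes the square around the midpoint `m`.
    have hpar : 2 * ‖x - z‖ ^ 2 + 2 * ‖y - z‖ ^ 2 = ‖x - y‖ ^ 2 + 4 * ‖z - m‖ ^ 2 := by
      have h := parallelogram_law_with_norm ℝ (x - z) (y - z)
      have e1 : x - z + (y - z) = -((2 : ℝ) • (z - m)) := by
        simp only [m]; module
      have e2 : x - z - (y - z) = x - y := by abel
      rw [e1, e2, norm_neg, norm_smul] at h
      norm_num at h
      nlinarith
    rw [gaussFactor, gaussFactor, ← ENNReal.ofReal_mul (by positivity)]
    congr 1
    rw [mul_mul_mul_comm, ← Real.exp_add, mul_assoc (c ^ 2), ← Real.exp_add, sq c]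
    congr 2
    linear_combination (-t ^ 2) * hpar
  simp_rw [key]
  rw [← ofReal_integral_eq_lintegral_ofReal
    ((hint.comp_sub_right m).const_mul _) (ae_of_all _ fun z => by positivity),
    integral_const_mul, integral_sub_right_eq_self (fun z : R3 => Real.exp (-(4 * t ^ 2) * ‖z‖ ^ 2)),
    GaussianFourier.integral_rexp_neg_mul_sq_norm h4]
  congr 1
  -- The exponent -3/4 is chosen so that `c ^ 2` cancels the three-dimensional Gaussian integral.
  have : c ^ 2 * (Real.pi / (4 * t ^ 2)) ^ ((Module.finrank ℝ R3 : ℝ) / 2) = 1 := by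
    rw [← Real.rpow_natCast, ← Real.rpow_mul hb.le, ← Real.rpow_add hb]
    simp only [finrank_euclideanSpace, Fintype.card_fin]
    norm_num
  linear_combination Real.exp (-t ^ 2 * ‖x - y‖ ^ 2) * this

/-- The Coulomb kernel on `ℝ³` as a superposition of products of Gaussians. -/
lemma coulomb_kernel_eq {x y : R3} (h : x ≠ y) :
    ENNReal.ofReal (‖x - y‖⁻¹) = ENNReal.ofReal (2 / √Real.pi) *
      ∫⁻ p, gaussFactor p x * gaussFactor p y ∂((volume.restrict (Ioi (0 : ℝ))).prod volume) := by
  have hr : 0 < ‖x - y‖ := norm_pos_iff.2 (sub_ne_zero.2 h)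
  have hm (x : R3) : Measurable fun p => gaussFactor p x := measurable_gaussFactor.of_uncurry_right
  rw [lintegral_prod _ ((hm x).fun_mul (hm y)).aemeasurable,
    setLIntegral_congr_fun measurableSet_Ioi fun t ht => lintegral_gaussFactor_mul x y ht]
  have hg (t : ℝ) : -t ^ 2 * ‖x - y‖ ^ 2 = -(‖x - y‖ ^ 2) * t ^ 2 := by ring
  simp_rw [hg]
  rw [← ofReal_integral_eq_lintegral_ofReal
    (integrable_exp_neg_mul_sq (by positivity)).integrableOn
    (ae_of_all _ fun z => by positivity), integral_gaussian_Ioi,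
    ← ENNReal.ofReal_mul (by positivity), Real.sqrt_div Real.pi_pos.le, Real.sqrt_sq hr.le]
  congr 1
  field_simp

/-- The Coulomb energy of two densities, with values in `[0, ∞]`. -/
noncomputable def coulomb (f g : R3 → ℝ≥0∞) : ℝ≥0∞ :=
  ∫⁻ x, ∫⁻ y, f x * g y * ENNReal.ofReal (‖x - y‖⁻¹)

lemma coulomb_comm {f g : R3 → ℝ≥0∞} (hf : Measurable f) (hg : Measurable g) :
    coulomb f g = coulomb g f := by
  unfold coulomb
  rw [lintegral_lintegral_swap (Measurable.aemeasurable ?_)]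
  · refine lintegral_congr fun x => lintegral_congr fun y => ?_
    rw [mul_comm (f y), norm_sub_rev]
  · unfold Function.uncurry
    fun_prop

lemma coulomb_eq_gauss (f g : R3 → ℝ≥0∞) :
    coulomb f g = ENNReal.ofReal (2 / √Real.pi) * ∫⁻ x, ∫⁻ y, f x * g y *
      ∫⁻ p, gaussFactor p x * gaussFactor p y ∂((volume.restrict (Ioi (0 : ℝ))).prod volume) := by
  rw [← lintegral_const_mul' _ _ ENNReal.ofReal_ne_top]
  refine lintegral_congr fun x => ?_
  rw [← lintegral_const_mul' _ _ ENNReal.ofReal_ne_top]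
  refine lintegral_congr_ae ?_
  -- The diagonal must be discarded: there the left kernel is 0 by the convention `0⁻¹ = 0`.
  have : ∀ᵐ y : R3, y ≠ x := by simp [ae_iff]
  filter_upwards [this] with y hy
  rw [coulomb_kernel_eq hy.symm]
  ring

/-- Cauchy–Schwarz inequality for the Coulomb energy. -/
lemma coulomb_le {f g : R3 → ℝ≥0∞} (hf : Measurable f) (hg : Measurable g) :
    coulomb f g ≤ coulomb f f ^ (1 / 2 : ℝ) * coulomb g g ^ (1 / 2 : ℝ) := by
  rw [coulomb_eq_gauss f g, coulomb_eq_gauss f f, coulomb_eq_gauss g g,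
    ENNReal.mul_rpow_of_nonneg _ _ (by norm_num), ENNReal.mul_rpow_of_nonneg _ _ (by norm_num),
    mul_mul_mul_comm, ← ENNReal.rpow_add_of_nonneg _ _ (by norm_num) (by norm_num)]
  norm_num only [ENNReal.rpow_one]
  gcongr
  simpa only [one_div] using lintegral_factored_kernel_le measurable_gaussFactor hf hg

/-! ### Almost everywhere finiteness of the Newtonian potential -/

/-- `|x|⁻¹` has uniformly bounded integrals over translates of a ball. -/
lemma lintegral_ball_inv_norm_sub_le (R : ℝ) : ∃ C : ℝ≥0∞, C ≠ ∞ ∧ ∀ y : R3,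
    ∫⁻ x in Metric.ball (0 : R3) R, ENNReal.ofReal (‖x - y‖⁻¹) ≤ C := by
  have hloc : IntegrableOn (fun x : R3 => ‖x‖⁻¹) (Metric.ball 0 1) := by
    -- In polar coordinates the radial integrand is r² · r⁻¹ = r.
    rw [integrableOn_fun_norm_addHaar volume (f := fun r => r⁻¹)]
    have : IntegrableOn (fun y : ℝ => y) (Ioo 0 1) :=
      (continuous_id.integrableOn_Icc (a := (0 : ℝ)) (b := 1)).mono_set Ioo_subset_Icc_self
    refine this.congr_fun (fun r hr => ?_) measurableSet_Ioo
    have := hr.1.ne'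
    simp only [finrank_euclideanSpace, Fintype.card_fin, smul_eq_mul]
    field_simp
  set I : ℝ≥0∞ := ∫⁻ x in Metric.ball (0 : R3) 1, ENNReal.ofReal (‖x‖⁻¹)
  have hI : I ≠ ∞ := by
    have := hloc.hasFiniteIntegral
    rw [hasFiniteIntegral_iff_ofReal (ae_of_all _ fun x => by positivity)] at this
    exact this.ne
  refine ⟨I + volume (Metric.ball (0 : R3) R),
    ENNReal.add_ne_top.2 ⟨hI, measure_ball_lt_top.ne⟩, fun y => ?_⟩
  have hpt (z : R3) : ENNReal.ofReal (‖z‖⁻¹) ≤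
      (Metric.ball (0 : R3) 1).indicator (fun z => ENNReal.ofReal (‖z‖⁻¹)) z + 1 := by
    by_cases hz : z ∈ Metric.ball (0 : R3) 1
    · simp [indicator_of_mem hz]
    · rw [indicator_of_notMem hz, zero_add, ENNReal.ofReal_le_one]
      exact inv_le_one_of_one_le₀ (by simpa using hz)
  have hm : Measurable ((Metric.ball (0 : R3) 1).indicator fun z => ENNReal.ofReal (‖z‖⁻¹)) :=
    Measurable.indicator (by fun_prop) measurableSet_ball
  calc ∫⁻ x in Metric.ball (0 : R3) R, ENNReal.ofReal (‖x - y‖⁻¹)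
      ≤ ∫⁻ x in Metric.ball (0 : R3) R,
        ((Metric.ball (0 : R3) 1).indicator (fun z => ENNReal.ofReal (‖z‖⁻¹)) (x - y) + 1) :=
        lintegral_mono fun x => hpt _
    _ = (∫⁻ x in Metric.ball (0 : R3) R,
        (Metric.ball (0 : R3) 1).indicator (fun z => ENNReal.ofReal (‖z‖⁻¹)) (x - y)) +
        volume (Metric.ball (0 : R3) R) := by
        rw [lintegral_add_right _ measurable_const]; simp
    _ ≤ (∫⁻ x,
        (Metric.ball (0 : R3) 1).indicator (fun z => ENNReal.ofReal (‖z‖⁻¹)) (x - y)) +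
        volume (Metric.ball (0 : R3) R) := by
        gcongr
        exact Measure.restrict_le_self
    _ = I + volume (Metric.ball (0 : R3) R) := by
        rw [lintegral_sub_right_eq_self
          ((Metric.ball (0 : R3) 1).indicator (fun z => ENNReal.ofReal (‖z‖⁻¹))) y,
          lintegral_indicator measurableSet_ball]

/-- The Newtonian potential of an integrable density is finite almost everywhere. -/
lemma ae_lintegral_mul_inv_norm_lt_top {f : R3 → ℝ≥0∞} (hf : Measurable f)
    (hfi : ∫⁻ y, f y ≠ ∞) : ∀ᵐ x : R3, ∫⁻ y, f y * ENNReal.ofReal (‖x - y‖⁻¹) < ∞ := by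
  have hmeas : Measurable fun x : R3 => ∫⁻ y, f y * ENNReal.ofReal (‖x - y‖⁻¹) := by
    apply Measurable.lintegral_prod_right'
      (f := fun q : R3 × R3 => f q.2 * ENNReal.ofReal (‖q.1 - q.2‖⁻¹))
    fun_prop
  have hball (n : ℕ) : ∀ᵐ x : R3, x ∈ Metric.ball (0 : R3) n →
      ∫⁻ y, f y * ENNReal.ofReal (‖x - y‖⁻¹) < ∞ := by
    rw [← ae_restrict_iff' measurableSet_ball]
    refine ae_lt_top hmeas ?_
    obtain ⟨C, hC, hCle⟩ := lintegral_ball_inv_norm_sub_le n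
    refine ne_top_of_le_ne_top (ENNReal.mul_ne_top hfi hC) ?_
    rw [lintegral_lintegral_swap (Measurable.aemeasurable (by unfold Function.uncurry; fun_prop)),
      ← lintegral_mul_const _ hf]
    refine lintegral_mono fun y => ?_
    rw [lintegral_const_mul _ (by fun_prop)]
    gcongr
    exact hCle y
  filter_upwards [ae_all_iff.2 hball] with x hx
  obtain ⟨n, hn⟩ := exists_nat_gt ‖x‖
  exact hx n (by simpa using hn)

/-! ### The Fourier side -/

lemma hat_smul (c : ℝ) (u : L2) : hat (c • u) = (c : ℂ) • hat u := by
  have h : Complex.ofRealCLM.compLp (c • u) = (c : ℂ) • Complex.ofRealCLM.compLp u := by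
    ext1
    filter_upwards [Complex.ofRealCLM.coeFn_compLp (c • u), Complex.ofRealCLM.coeFn_compLp u,
      Lp.coeFn_smul c u, Lp.coeFn_smul (c : ℂ) (Complex.ofRealCLM.compLp u)] with x h1 h2 h3 h4
    rw [h1, h4, Pi.smul_apply, h2, h3]
    simp
  rw [hat, h, FourierTransform.fourier_smul, ← hat]

lemma hat_smul_ae (c : ℝ) (u : L2) : ∀ᵐ ξ, hat (c • u) ξ = (c : ℂ) * hat u ξ := by
  rw [hat_smul]
  filter_upwards [Lp.coeFn_smul (c : ℂ) (hat u)] with ξ h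
  rw [h, Pi.smul_apply, smul_eq_mul]

lemma eq_zero_of_hat_eq_zero {u : L2} (h : hat u = 0) : u = 0 := by
  have h0 : Complex.ofRealCLM.compLp u = 0 := by
    rw [← norm_eq_zero, ← Lp.norm_fourier_eq]
    exact norm_eq_zero.2 h
  ext1
  have h1 := Complex.ofRealCLM.coeFn_compLp u
  rw [h0] at h1
  filter_upwards [h1, Lp.coeFn_zero ℂ 2 (volume : Measure R3),
    Lp.coeFn_zero ℝ 2 (volume : Measure R3)] with x h2 h3 h4
  rw [h3] at h2
  rw [h4]
  simpa using h2.symm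

lemma weight_pos (ξ : R3) : 0 < 1 + 2 * Real.pi * ‖ξ‖ := by positivity

lemma normSq_nonneg (u : L2) : 0 ≤ normSq u :=
  integral_nonneg fun ξ => mul_nonneg (weight_pos ξ).le (by positivity)

lemma normSq_pos {u : L2} (hu : u ∈ Hhalf) (h0 : u ≠ 0) : 0 < normSq u := by
  refine (normSq_nonneg u).lt_of_ne fun h => h0 (eq_zero_of_hat_eq_zero ?_)
  have h1 := (integral_eq_zero_iff_of_nonneg
    (fun ξ => mul_nonneg (weight_pos ξ).le (by positivity)) hu).1 h.symm
  ext1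
  filter_upwards [h1, Lp.coeFn_zero ℂ 2 (volume : Measure R3)] with ξ h2 h3
  rw [h3]
  simpa [(weight_pos ξ).ne'] using h2

lemma weighted_hat_smul_ae (c : ℝ) (u : L2) :
    (fun ξ : R3 => (1 + 2 * Real.pi * ‖ξ‖) * ‖hat (c • u) ξ‖ ^ 2) =ᵐ[volume]
      fun ξ => c ^ 2 * ((1 + 2 * Real.pi * ‖ξ‖) * ‖hat u ξ‖ ^ 2) := by
  filter_upwards [hat_smul_ae c u] with ξ h
  rw [h, norm_mul, mul_pow, Complex.norm_real, Real.norm_eq_abs, sq_abs]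
  ring

lemma smul_mem_Hhalf (c : ℝ) {u : L2} (hu : u ∈ Hhalf) : c • u ∈ Hhalf :=
  (Integrable.const_mul hu (c ^ 2)).congr (weighted_hat_smul_ae c u).symm

lemma normSq_smul (c : ℝ) (u : L2) : normSq (c • u) = c ^ 2 * normSq u := by
  rw [normSq, integral_congr_ae (weighted_hat_smul_ae c u), integral_const_mul, ← normSq]

lemma normSq_zero : normSq 0 = 0 := by
  simpa using normSq_smul 0 0

lemma form_smul_left (c : ℝ) (u w : L2) : form (c • u) w = c * form u w := by
  rw [form, form, ← integral_const_mul]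
  refine integral_congr_ae ?_
  filter_upwards [hat_smul_ae c u] with ξ h
  rw [h, mul_assoc (c : ℂ), Complex.re_ofReal_mul]
  ring

/-! ### The Hartree potential and the Coulomb energy -/

lemma measurable_coe (u : L2) : Measurable u := (Lp.stronglyMeasurable u).measurable

/-- The density `u²` with values in `[0, ∞]`. -/
noncomputable def density (u : L2) (x : R3) : ℝ≥0∞ := ENNReal.ofReal (u x ^ 2)

lemma measurable_density (u : L2) : Measurable (density u) :=
  ((measurable_coe u).pow_const 2).ennreal_ofReal

lemma lintegral_density_ne_top (u : L2) : ∫⁻ x, density u x ≠ ∞ := by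
  have h := (Lp.memLp u).integrable_sq.hasFiniteIntegral
  rw [hasFiniteIntegral_iff_ofReal (ae_of_all _ fun x => by positivity)] at h
  exact h.ne

lemma phi_nonneg (u : L2) (x : R3) : 0 ≤ phi u x :=
  integral_nonneg fun y => by positivity

lemma measurable_phi (u : L2) : Measurable (phi u) := by
  have hu := measurable_coe u
  have : StronglyMeasurable fun q : R3 × R3 => u q.2 ^ 2 / ‖q.1 - q.2‖ :=
    Measurable.stronglyMeasurable (by fun_prop)
  exact this.integral_prod_right'.measurable

/-- Finiteness of the potential almost everywhere excludes the default value 0 of a divergent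
Bochner integral. -/
lemma ofReal_phi_ae (u : L2) : ∀ᵐ x : R3,
    ENNReal.ofReal (phi u x) = ∫⁻ y, density u y * ENNReal.ofReal (‖x - y‖⁻¹) := by
  have hu := measurable_coe u
  filter_upwards [ae_lintegral_mul_inv_norm_lt_top (measurable_density u)
    (lintegral_density_ne_top u)] with x hx
  have e : ∫⁻ y, ENNReal.ofReal (u y ^ 2 / ‖x - y‖) =
      ∫⁻ y, density u y * ENNReal.ofReal (‖x - y‖⁻¹) := by
    refine lintegral_congr fun y => ?_
    rw [density, ← ENNReal.ofReal_mul (by positivity), div_eq_mul_inv]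
  rw [phi, integral_eq_lintegral_of_nonneg_ae (ae_of_all _ fun y => by positivity)
    (Measurable.aestronglyMeasurable (by fun_prop)), e, ENNReal.ofReal_toReal hx.ne]

lemma phi_mul_sq_nonneg (u v : L2) (x : R3) : 0 ≤ phi u x * v x ^ 2 :=
  mul_nonneg (phi_nonneg u x) (sq_nonneg _)

lemma measurable_phi_mul_sq (u v : L2) : Measurable fun x => phi u x * v x ^ 2 :=
  (measurable_phi u).mul ((measurable_coe v).pow_const 2)

lemma lintegral_phi_mul_sq (u v : L2) :
    ∫⁻ x, ENNReal.ofReal (phi u x * v x ^ 2) = coulomb (density v) (density u) := by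
  refine lintegral_congr_ae ?_
  filter_upwards [ofReal_phi_ae u] with x hx
  have hu := measurable_density u
  rw [ENNReal.ofReal_mul (phi_nonneg u x), hx, mul_comm, ← density,
    ← lintegral_const_mul _ (by fun_prop)]
  refine lintegral_congr fun y => ?_
  ring

lemma D_eq_toReal_coulomb (u v : L2) : D u v = (coulomb (density v) (density u)).toReal := by
  rw [D, integral_eq_lintegral_of_nonneg_ae (ae_of_all _ (phi_mul_sq_nonneg u v))
    (measurable_phi_mul_sq u v).aestronglyMeasurable, lintegral_phi_mul_sq]

lemma integrable_phi_mul_sq_iff (u v : L2) :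
    Integrable (fun x => phi u x * v x ^ 2) ↔ coulomb (density v) (density u) < ∞ := by
  rw [← lintegral_phi_mul_sq,
    ← hasFiniteIntegral_iff_ofReal (ae_of_all _ (phi_mul_sq_nonneg u v))]
  exact and_iff_right (measurable_phi_mul_sq u v).aestronglyMeasurable

lemma D_nonneg (u v : L2) : 0 ≤ D u v := integral_nonneg (phi_mul_sq_nonneg u v)

lemma D_comm (u v : L2) : D u v = D v u := by
  rw [D_eq_toReal_coulomb, D_eq_toReal_coulomb,
    coulomb_comm (measurable_density v) (measurable_density u)]

/-- Cauchy–Schwarz inequality `(∫ φ_u v²)² ≤ (∫ φ_u u²) (∫ φ_v v²)`. -/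
lemma D_sq_le {u v : L2} (hu : Integrable fun x => phi u x * u x ^ 2)
    (hv : Integrable fun x => phi v x * v x ^ 2) : D u v ^ 2 ≤ D u u * D v v := by
  rw [integrable_phi_mul_sq_iff] at hu hv
  have h := coulomb_le (measurable_density v) (measurable_density u)
  have h1 : D u v ≤ D v v ^ (1 / 2 : ℝ) * D u u ^ (1 / 2 : ℝ) := by
    simp only [D_eq_toReal_coulomb, ENNReal.toReal_rpow]
    rw [← ENNReal.toReal_mul]
    exact ENNReal.toReal_mono (ENNReal.mul_ne_top (ENNReal.rpow_ne_top_of_nonneg (by norm_num) hv.ne)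
      (ENNReal.rpow_ne_top_of_nonneg (by norm_num) hu.ne)) h
  rw [← Real.sqrt_eq_rpow, ← Real.sqrt_eq_rpow] at h1
  calc D u v ^ 2 ≤ (√(D v v) * √(D u u)) ^ 2 := pow_le_pow_left₀ (D_nonneg u v) h1 2
    _ = D u u * D v v := by
      rw [mul_pow, Real.sq_sqrt (D_nonneg v v), Real.sq_sqrt (D_nonneg u u), mul_comm]

lemma phi_smul (c : ℝ) (u : L2) (x : R3) : phi (c • u) x = c ^ 2 * phi u x := by
  rw [phi, phi, ← integral_const_mul]
  refine integral_congr_ae ?_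
  filter_upwards [Lp.coeFn_smul c u] with y h
  rw [h, Pi.smul_apply, smul_eq_mul]
  ring

lemma D_smul (c : ℝ) (u : L2) : D (c • u) (c • u) = c ^ 4 * D u u := by
  rw [D, D, ← integral_const_mul]
  refine integral_congr_ae ?_
  filter_upwards [Lp.coeFn_smul c u] with y h
  rw [h, Pi.smul_apply, smul_eq_mul, phi_smul]
  ring

/-! ### The scalar ground state -/

/-- The sharp inequality `‖Q‖² ∫ φ_u u² ≤ ‖u‖⁴` characterizing a scalar ground state `Q`. -/
lemma IsScalarGroundState.normSq_mul_D_le {Q : L2} (hQ : IsScalarGroundState Q) {u : L2}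
    (hu : u ∈ Hhalf) : normSq Q * D u u ≤ normSq u ^ 2 := by
  obtain ⟨-, ⟨-, -, hQN⟩, hmin⟩ := hQ
  rcases (D_nonneg u u).eq_or_lt with hD | hD
  -- This case also absorbs a divergent Coulomb energy, for which `D` is 0 by default.
  · rw [← hD, mul_zero]
    positivity
  by_cases h0 : u = 0
  · subst h0
    have := D_smul 0 0
    simp only [zero_smul] at this
    norm_num at this
    exact absurd this hD.ne'
  have hA := normSq_pos hu h0
  -- The solution of t²‖u‖² = t⁴ D(u, u), which puts `t • u` on the Nehari manifold.
  set t : ℝ := √(normSq u / D u u) with ht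
  have ht0 : 0 < t := Real.sqrt_pos.2 (div_pos hA hD)
  have ht2 : t ^ 2 = normSq u / D u u := Real.sq_sqrt (div_pos hA hD).le
  have hmem : t • u ∈ scalarNehari := by
    refine ⟨smul_mem_Hhalf t hu, smul_ne_zero ht0.ne' h0, ?_⟩
    rw [normSq_smul, D_smul, show t ^ 4 = (t ^ 2) ^ 2 by ring, ht2]
    field_simp
  have h : scalarEnergy Q ≤ scalarEnergy (t • u) := hmin hmem
  rw [scalarEnergy, scalarEnergy, ← hQN, ← hmem.2.2, normSq_smul, ht2] at h
  have h2 : normSq Q ≤ normSq u / D u u * normSq u := by linarith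
  calc normSq Q * D u u ≤ normSq u / D u u * normSq u * D u u :=
        mul_le_mul_of_nonneg_right h2 hD.le
    _ = normSq u ^ 2 := by field_simp

/-! ### The Nehari constraints of the system -/

variable {a β : ℝ} {u v : L2}

lemma NehariConstraints.swap (h : NehariConstraints a β (u, v)) :
    NehariConstraints a β (v, u) :=
  ⟨h.2.1, h.1, h.2.2.2, h.2.2.1⟩

/-- The integrand in the first constraint is nonnegative and its integral is the finite number
`‖u‖²`, which is positive unless `u = 0`; hence both of its terms are integrable. -/
lemma NehariConstraints.integrable_fst (ha : 0 < a) (hβ : 0 < β)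
    (h : NehariConstraints a β (u, v)) :
    Integrable (fun x => phi u x * u x ^ 2) ∧ Integrable fun x => phi v x * u x ^ 2 := by
  by_cases h0 : u = 0
  · have hz : ∀ᵐ x : R3, u x = 0 := by
      rw [h0]
      exact Lp.coeFn_zero ℝ 2 (volume : Measure R3)
    have hI (w : L2) : Integrable fun x => phi w x * u x ^ 2 := by
      refine (integrable_zero R3 ℝ volume).congr ?_
      filter_upwards [hz] with x hx
      simp [hx]
    exact ⟨hI u, hI v⟩
  have hsum : Integrable fun x => a * (phi u x * u x ^ 2) + β * (phi v x * u x ^ 2) := by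
    refine .of_integral_ne_zero ?_
    rw [← h.2.2.1]
    exact (normSq_pos h.1 h0).ne'
  have hI {c : ℝ} (hc : 0 < c) (w : L2) (hle : ∀ x, c * (phi w x * u x ^ 2) ≤
      a * (phi u x * u x ^ 2) + β * (phi v x * u x ^ 2)) :
      Integrable fun x => phi w x * u x ^ 2 := by
    have h1 : Integrable fun x => c * (phi w x * u x ^ 2) := by
      refine hsum.mono' ((measurable_phi_mul_sq w u).const_mul c).aestronglyMeasurable
        (ae_of_all _ fun x => ?_)
      rw [Real.norm_of_nonneg (mul_nonneg hc.le (phi_mul_sq_nonneg w u x))]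
      exact hle x
    exact (integrable_const_mul_iff hc.ne'.isUnit _).1 h1
  exact ⟨hI ha u fun x => le_add_of_nonneg_right (mul_nonneg hβ.le (phi_mul_sq_nonneg v u x)),
    hI hβ v fun x => le_add_of_nonneg_left (mul_nonneg ha.le (phi_mul_sq_nonneg u u x))⟩

lemma NehariConstraints.normSq_fst_eq (ha : 0 < a) (hβ : 0 < β)
    (h : NehariConstraints a β (u, v)) : normSq u = a * D u u + β * D v u := by
  obtain ⟨h1, h2⟩ := h.integrable_fst ha hβ
  rw [h.2.2.1, integral_add (h1.const_mul a) (h2.const_mul β), integral_const_mul,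
    integral_const_mul, ← D, ← D]

/-- The sum of the constraints identifies the quartic part with the quadratic one, leaving 1/2 - 1/4
of the latter. -/
lemma NehariConstraints.J_eq (ha : 0 < a) (hβ : 0 < β)
    (h : NehariConstraints a β (u, v)) : J a β (u, v) = (normSq u + normSq v) / 4 := by
  obtain ⟨h1, -⟩ := h.integrable_fst ha hβ
  obtain ⟨h3, h4⟩ := h.swap.integrable_fst ha hβ
  have e1 := h.normSq_fst_eq ha hβ
  have e2 := h.swap.normSq_fst_eq ha hβ
  dsimp only [J]
  rw [integral_add ((h1.const_mul a).fun_add (h3.const_mul a)) (h4.const_mul (2 * β)),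
    integral_add (h1.const_mul a) (h3.const_mul a), integral_const_mul, integral_const_mul,
    integral_const_mul, ← D, ← D, ← D]
  rw [D_comm v u] at e1
  linarith

lemma NehariConstraints.le_of_fst_ne_zero {Q : L2} (hQ : IsScalarGroundState Q)
    (ha : 0 < a) (hβ : 0 < β) (h : NehariConstraints a β (u, v)) (hu : u ≠ 0) :
    normSq Q ≤ a * normSq u + β * normSq v := by
  obtain ⟨h1, -⟩ := h.integrable_fst ha hβ
  obtain ⟨h3, -⟩ := h.swap.integrable_fst ha hβ
  have hM : 0 < normSq Q := normSq_pos hQ.2.1.1 hQ.2.1.2.1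
  have hA : 0 < normSq u := normSq_pos h.1 hu
  have hB : 0 ≤ normSq v := normSq_nonneg v
  have huu := hQ.normSq_mul_D_le h.1
  have hvv := hQ.normSq_mul_D_le h.2.1
  have huv : normSq Q * D v u ≤ normSq u * normSq v := by
    refine abs_le_of_sq_le_sq' ?_ (by positivity) |>.2
    calc (normSq Q * D v u) ^ 2 = normSq Q ^ 2 * D v u ^ 2 := by ring
      _ ≤ normSq Q ^ 2 * (D v v * D u u) := by gcongr; exact D_sq_le h3 h1
      _ = (normSq Q * D u u) * (normSq Q * D v v) := by ring
      _ ≤ normSq u ^ 2 * normSq v ^ 2 :=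
        mul_le_mul huu hvv (mul_nonneg hM.le (D_nonneg v v)) (by positivity)
      _ = _ := by ring
  refine le_of_mul_le_mul_left ?_ hA
  calc normSq u * normSq Q = a * (normSq Q * D u u) + β * (normSq Q * D v u) := by
        rw [h.normSq_fst_eq ha hβ]; ring
    _ ≤ a * normSq u ^ 2 + β * (normSq u * normSq v) := by gcongr
    _ = _ := by ring

/-! ### Synchronized pairs -/

/-- The right-hand side is cubic, so its coefficient is √k (ak + βl) = √k; the integrands agree a.e.
and no integrability is needed. -/
lemma sqrt_smul_solution {Q : L2} (hQ : IsScalarSolution Q) {k l : ℝ} (hk : 0 < k) (hl : 0 < l)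
    (h1 : a * k + β * l = 1) {w : L2} (hw : w ∈ Hhalf) :
    form (√k • Q) w = ∫ x : R3, (a * phi (√k • Q) x * (√k • Q : L2) x +
      β * phi (√l • Q) x * (√k • Q : L2) x) * w x := by
  rw [form_smul_left, hQ.2 w hw, ← integral_const_mul]
  refine integral_congr_ae ?_
  filter_upwards [Lp.coeFn_smul (√k) Q] with x hx
  rw [hx, phi_smul, phi_smul, Real.sq_sqrt hk.le, Real.sq_sqrt hl.le, Pi.smul_apply, smul_eq_mul]
  linear_combination (-√k * phi Q x * Q x * w x) * h1

lemma normSq_sqrt_smul {Q : L2} (hQ : normSq Q = D Q Q) {k l : ℝ} (hk : 0 < k) (hl : 0 < l)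
    (h1 : a * k + β * l = 1) :
    normSq (√k • Q) = ∫ x : R3, (a * (phi (√k • Q) x * (√k • Q : L2) x ^ 2) +
      β * (phi (√l • Q) x * (√k • Q : L2) x ^ 2)) := by
  rw [normSq_smul, hQ, D, ← integral_const_mul]
  refine integral_congr_ae ?_
  filter_upwards [Lp.coeFn_smul (√k) Q] with x hx
  rw [hx, phi_smul, phi_smul, Real.sq_sqrt hk.le, Real.sq_sqrt hl.le, Pi.smul_apply, smul_eq_mul,
    mul_pow, Real.sq_sqrt hk.le]
  linear_combination (-k * phi Q x * Q x ^ 2) * h1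

end Hartree

/-! ### The ground state theorem -/

open Hartree

theorem lemma4p1 (Q : Hartree.L2) (hQ : Hartree.IsScalarGroundState Q)
    (a β : ℝ) (ha : 0 < a) (hβ : 0 < β) (hne : a ≠ β)
    (k l : ℝ) (hk : 0 < k) (hl : 0 < l)
    (h1 : a * k + β * l = 1) (h2 : a * l + β * k = 1) :
    Hartree.IsGroundState a β (Real.sqrt k • Q, Real.sqrt l • Q) ∧
      (a < β → IsMinOn (Hartree.J a β) (Hartree.nehariWide a β)
        (Real.sqrt k • Q, Real.sqrt l • Q)) := by
  obtain ⟨hsol, ⟨hQH, hQ0, hQN⟩, -⟩ := id hQ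
  have hM : 0 < normSq Q := normSq_pos hQH hQ0
  have hcon : NehariConstraints a β (√k • Q, √l • Q) :=
    ⟨smul_mem_Hhalf _ hQH, smul_mem_Hhalf _ hQH, normSq_sqrt_smul hQN hk hl h1,
      normSq_sqrt_smul hQN hl hk h2⟩
  have hJ : J a β (√k • Q, √l • Q) = (k + l) * normSq Q / 4 := by
    rw [hcon.J_eq ha hβ, normSq_smul, normSq_smul, Real.sq_sqrt hk.le, Real.sq_sqrt hl.le]
    ring
  have hab : 0 < a + β := by positivity
  have hkl : (a + β) * (k + l) = 2 := by linear_combination h1 + h2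
  have hbound {u v : L2} (hc : NehariConstraints a β (u, v))
      (h : 2 * normSq Q ≤ (a + β) * (normSq u + normSq v)) :
      J a β (√k • Q, √l • Q) ≤ J a β (u, v) := by
    rw [hJ, hc.J_eq ha hβ]
    have : (k + l) * normSq Q ≤ normSq u + normSq v := by
      refine le_of_mul_le_mul_left ?_ hab
      rwa [← mul_assoc, hkl]
    linarith
  have hmin : IsMinOn (J a β) (nehari a β) (√k • Q, √l • Q) := by
    rintro ⟨u, v⟩ ⟨hu, hv, hc⟩
    refine hbound hc ?_
    have e1 := hc.le_of_fst_ne_zero hQ ha hβ hu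
    have e2 := hc.swap.le_of_fst_ne_zero hQ ha hβ hv
    linarith
  refine ⟨⟨⟨smul_mem_Hhalf _ hQH, smul_mem_Hhalf _ hQH,
      fun w hw => sqrt_smul_solution hsol hk hl h1 hw,
      fun w hw => sqrt_smul_solution hsol hl hk h2 hw⟩,
    ⟨smul_ne_zero (Real.sqrt_pos.2 hk).ne' hQ0, smul_ne_zero (Real.sqrt_pos.2 hl).ne' hQ0, hcon⟩,
    hmin⟩, fun hlt => ?_⟩
  rintro ⟨u, v⟩ ⟨h0, hc⟩
  by_cases hu : u = 0
  · have hv : v ≠ 0 := fun hv => h0 (by rw [hu, hv])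
    have e := hc.swap.le_of_fst_ne_zero hQ ha hβ hv
    refine hbound hc ?_
    rw [hu, normSq_zero] at e ⊢
    -- Here `a < β` enters: 2a‖v‖² ≤ (a + β)‖v‖².
    nlinarith [normSq_nonneg v]
  by_cases hv : v = 0
  · have e := hc.le_of_fst_ne_zero hQ ha hβ hu
    refine hbound hc ?_
    rw [hv, normSq_zero] at e ⊢
    nlinarith [normSq_nonneg u]
  exact hmin ⟨hu, hv, hc⟩
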